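/- Let $(\Omega,\Sigma)$ be a measurable space and let $\nu:\Sigma\to[0,1]$ be a convex capacity: $\nu(\emptyset)=0$, $\nu(\Omega)=1$, $\nu(A)\le\nu(B)$ whenever $A\subseteq B$, and $\nu(A\cup B)+\nu(A\cap B)\ge\nu(A)+\nu(B)$ for all $A,B\in\Sigma$. Let $C_\nu$ be its core, i.e. the set of finitely additive probability measures $p$ on $(\Omega,\Sigma)$ with $p(A)\ge\nu(A)$ for all $A\in\Sigma$. Let $E\in\Sigma$ satisfy $\nu(E)>0$, let $C^*_\nu(E)$ be the set of those $p\in C_\nu$ that maximize $p(E)$ over $C_\nu$, and let $\alpha\in[0,1]$. For $A\in\Sigma$ put $$\nu^{E\text{-}RML}_E(A)=\frac{\alpha\,(\nu(A\cup E^c)-\nu(E^c))+(1-\alpha)\,\nu(A\cap E)}{\alpha\,(1-\nu(E^c))+(1-\alpha)\,(\nu(A\cap E)+1-\nu(A\cup E^c))},\qquad \nu^{FH}_E(A)=\frac{\nu(A\cap E)}{\nu(A\cap E)+1-\nu(A\cup E^c)},$$ and let $\alpha C^*_\nu(E)+(1-\alpha)C_\nu=\{\alpha q_1+(1-\alpha)q_2: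 q_1\in C^*_\nu(E),\ q_2\in C_\nu\}$. Then the denominator of $\nu^{E\text{-}RML}_E(A)$ is positive for every $A\in\Sigma$, $p(E)>0$ for every $p\in\alpha C^*_\nu(E)+(1-\alpha)C_\nu$, and: 1. $\nu^{E\text{-}RML}_E$ is a convex capacity on $(\Omega,\Sigma)$. 2. For every $A\in\Sigma$ the following minimum is attained and $$\nu^{E\text{-}RML}_E(A)=\min_{p\in\alpha C^*_\nu(E)+(1-\alpha)C_\nu}\frac{p(A\cap E)}{p(E)}.$$ 3. In the same way, for every $A\in\Sigma$ the following minimum is attained and $\nu^{FH}_E(A)=\min_{p\in C_\nu}\frac{p(A\cap E)}{p(E)}$. -/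

import Mathlib

/-- A (normalized) capacity on the sigma-algebra of measurable subsets of `Ω`: a set function that
vanishes at `∅`, is `1` at `Ω`, and is monotone on events. Only the values at events (measurable
sets) matter. -/
structure IsCapacity {Ω : Type*} [MeasurableSpace Ω] (ν : Set Ω → ℝ) : Prop where
  empty : ν ∅ = 0
  univ : ν Set.univ = 1
  mono : ∀ A B : Set Ω, MeasurableSet A → MeasurableSet B → A ⊆ B → ν A ≤ ν B

/-- A convex capacity: `ν (A ∪ B) + ν (A ∩ B) ≥ ν A + ν B` for all events `A`, `B`. -/
structure IsConvexCapacity {Ω : Type*} [MeasurableSpace Ω] (ν : Set Ω → ℝ) : Prop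
    extends IsCapacity ν where
  convex : ∀ A B : Set Ω, MeasurableSet A → MeasurableSet B →
    ν A + ν B ≤ ν (A ∪ B) + ν (A ∩ B)

/-- A finitely additive probability measure on the sigma-algebra of `Ω`. -/
structure IsFinAddProb {Ω : Type*} [MeasurableSpace Ω] (p : Set Ω → ℝ) : Prop where
  nonneg : ∀ A : Set Ω, MeasurableSet A → 0 ≤ p A
  univ : p Set.univ = 1
  add : ∀ A B : Set Ω, MeasurableSet A → MeasurableSet B → Disjoint A B →
    p (A ∪ B) = p A + p B

/-- The core of `ν`: the finitely additive probabilities that dominate `ν` on all events. -/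
def core {Ω : Type*} [MeasurableSpace Ω] (ν : Set Ω → ℝ) : Set (Set Ω → ℝ) :=
  {p | IsFinAddProb p ∧ ∀ A : Set Ω, MeasurableSet A → ν A ≤ p A}

/-- The elements of the core of `ν` that maximize the probability of `E` over the core. -/
def coreMax {Ω : Type*} [MeasurableSpace Ω] (ν : Set Ω → ℝ) (E : Set Ω) : Set (Set Ω → ℝ) :=
  {p | p ∈ core ν ∧ ∀ q ∈ core ν, q E ≤ p E}

/-- The set of priors `α C*(E) + (1 - α) C`, where `C` is the core of `ν`. -/
def mixedCore {Ω : Type*} [MeasurableSpace Ω] (ν : Set Ω → ℝ) (α : ℝ) (E : Set Ω) :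
    Set (Set Ω → ℝ) :=
  {p | ∃ q₁ ∈ coreMax ν E, ∃ q₂ ∈ core ν, p = fun A => α * q₁ A + (1 - α) * q₂ A}

/-- The denominator of the Extended RML conditional capacity. -/
noncomputable def extRMLDenom {Ω : Type*} (ν : Set Ω → ℝ) (α : ℝ) (E A : Set Ω) : ℝ :=
  α * (1 - ν Eᶜ) + (1 - α) * (ν (A ∩ E) + 1 - ν (A ∪ Eᶜ))

/-- The Extended RML conditional capacity of `ν` given `E`, with weight `α`. -/
noncomputable def extRML {Ω : Type*} (ν : Set Ω → ℝ) (α : ℝ) (E A : Set Ω) : ℝ :=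
  (α * (ν (A ∪ Eᶜ) - ν Eᶜ) + (1 - α) * ν (A ∩ E)) / extRMLDenom ν α E A

/-- The Fagin-Halpern conditional capacity of `ν` given `E`. -/
noncomputable def faginHalpern {Ω : Type*} (ν : Set Ω → ℝ) (E A : Set Ω) : ℝ :=
  ν (A ∩ E) / (ν (A ∩ E) + 1 - ν (A ∪ Eᶜ))

/-! Write the quotient as `n / (n + g)`, where `g = 1 - ν (A ∪ Eᶜ)`; it increases in `n` and
decreases in `g`. Every prior in the mixed set has conditional probability of this form, with `n`
and `g` at least those of `extRML`. Equality needs core elements exact on two nested events: `Eᶜ ⊆ A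
∪ Eᶜ` for the maximizing prior, `A ∩ E ⊆ A ∪ Eᶜ` for the other. `exists_modular_ge_eq` supplies them
by Zorn's lemma, since a maximal supermodular capacity is modular. Convexity of the quotient holds
because `n` is monotone and supermodular, `g` is submodular and `n + g` is antitone. The
Fagin-Halpern case is `α = 0`. -/

/-- A supermodular capacity on a bounded lattice. -/
structure IsSupermodularCapacity {L : Type*} [Lattice L] [BoundedOrder L] (v : L → ℝ) : Prop where
  bot : v ⊥ = 0
  top : v ⊤ = 1
  mono : Monotone v
  supermodular : ∀ x y, v x + v y ≤ v (x ⊔ y) + v (x ⊓ y)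

/-- The smallest increase of `v` that is modular with respect to `s` and keeps the value at `s`. -/
def modularizeAt {L : Type*} [Lattice L] (v : L → ℝ) (s x : L) : ℝ :=
  v (x ⊔ s) + v (x ⊓ s) - v s

/-! ### Modular set functions above a supermodular capacity -/

namespace IsSupermodularCapacity

variable {L : Type*} [DistribLattice L] [BoundedOrder L] {v : L → ℝ}

theorem le_modularizeAt (hv : IsSupermodularCapacity v) (s : L) : v ≤ modularizeAt v s := by
  intro x
  have := hv.supermodular x s
  simp only [modularizeAt]
  linarith

/-- By distributivity, joining with `s` and meeting with `s` both preserve joins and meets, so each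
term inherits supermodularity. -/
theorem isSupermodularCapacity_modularizeAt (hv : IsSupermodularCapacity v) (s : L) :
    IsSupermodularCapacity (modularizeAt v s) where
  bot := by simp [modularizeAt, hv.bot]
  top := by simp [modularizeAt, hv.top]
  mono x y hxy := by
    have h₁ := hv.mono (sup_le_sup_right hxy s)
    have h₂ := hv.mono (inf_le_inf_right s hxy)
    simp only [modularizeAt]
    linarith
  supermodular x y := by
    have h₁ := hv.supermodular (x ⊔ s) (y ⊔ s)
    have h₂ := hv.supermodular (x ⊓ s) (y ⊓ s)
    rw [← sup_sup_distrib_right, ← sup_inf_right] at h₁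
    rw [← inf_sup_right, ← inf_inf_distrib_right] at h₂
    simp only [modularizeAt]
    linarith

theorem exists_upperBound_of_isChain {c : Set (L → ℝ)} (hc : ∀ w ∈ c, IsSupermodularCapacity w)
    (hchain : IsChain (· ≤ ·) c) (hne : c.Nonempty) :
    ∃ u, IsSupermodularCapacity u ∧ ∀ w ∈ c, w ≤ u := by
  obtain ⟨w₀, hw₀⟩ := hne
  have : Nonempty c := ⟨⟨w₀, hw₀⟩⟩
  have hbdd : ∀ x, BddAbove (Set.range fun w : c => w.1 x) := by
    rintro x
    refine ⟨1, ?_⟩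
    rintro _ ⟨w, rfl⟩
    exact (hc w.1 w.2).top ▸ (hc w.1 w.2).mono le_top
  have hle : ∀ w ∈ c, ∀ x, w x ≤ ⨆ w : c, w.1 x := fun w hw x => le_ciSup (hbdd x) ⟨w, hw⟩
  refine ⟨fun x => ⨆ w : c, w.1 x, ⟨?_, ?_, ?_, ?_⟩, fun w hw x => hle w hw x⟩
  · simp [fun w : c => (hc w.1 w.2).bot]
  · simp [fun w : c => (hc w.1 w.2).top]
  · exact fun x y hxy => ciSup_mono (hbdd y) fun w => (hc w.1 w.2).mono hxy
  · intro x y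
    rw [← le_sub_iff_add_le]
    refine ciSup_le fun w => ?_
    rw [le_sub_comm]
    refine ciSup_le fun w' => ?_
    -- The two suprema on the left may be approached by different members; the chain provides one
    -- member above both.
    obtain ⟨z, hz, h, h'⟩ : ∃ z ∈ c, w.1 ≤ z ∧ w'.1 ≤ z := by
      rcases hchain.total w.2 w'.2 with h | h
      exacts [⟨w', w'.2, h, le_rfl⟩, ⟨w, w.2, le_rfl, h⟩]
    linarith [h x, h' y, (hc z hz).supermodular x y, hle z hz (x ⊔ y), hle z hz (x ⊓ y)]

/-- A supermodular capacity is dominated by a modular one. -/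
theorem exists_modular_ge (hv : IsSupermodularCapacity v) :
    ∃ p, IsSupermodularCapacity p ∧ v ≤ p ∧ ∀ x y, p (x ⊔ y) + p (x ⊓ y) = p x + p y := by
  obtain ⟨p, hvp, hp⟩ := zorn_le_nonempty₀ {w : L → ℝ | IsSupermodularCapacity w}
    (fun c hc hchain w hw => exists_upperBound_of_isChain hc hchain ⟨w, hw⟩) v hv
  have hp' : IsSupermodularCapacity p := hp.prop
  refine ⟨p, hp', hvp, fun x y => ?_⟩
  -- Maximality forbids a strict increase at `y`, which gives the submodular inequality.
  have h := hp.le_of_ge (hp'.isSupermodularCapacity_modularizeAt y) (hp'.le_modularizeAt y) x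
  have h' := hp'.supermodular x y
  simp only [modularizeAt] at h
  linarith

end IsSupermodularCapacity

/-- A supermodular capacity on a Boolean algebra is dominated by a modular one with the same values
at two given comparable elements. -/
theorem IsSupermodularCapacity.exists_modular_ge_eq {L : Type*} [BooleanAlgebra L] {v : L → ℝ}
    (hv : IsSupermodularCapacity v) {s t : L} (hst : s ≤ t) :
    ∃ p, IsSupermodularCapacity p ∧ v ≤ p ∧ (∀ x y, p (x ⊔ y) + p (x ⊓ y) = p x + p y) ∧
      p s = v s ∧ p t = v t := by
  have hs := hv.isSupermodularCapacity_modularizeAt s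
  obtain ⟨p, hp, hle, hmod⟩ := (hs.isSupermodularCapacity_modularizeAt t).exists_modular_ge
  have hle' : modularizeAt v s ≤ p := (hs.le_modularizeAt t).trans hle
  have hvp : v ≤ p := (hv.le_modularizeAt s).trans hle'
  -- Modularizing raises the values at `sᶜ` and `tᶜ` to `1 - v s` and `1 - v t`, which caps `p s`
  -- and `p t`. Modularizing at `s` leaves the value at `t` unchanged because `s ≤ t`.
  have h₁ := hle' sᶜ
  have h₂ := hle tᶜ
  have h₃ := hmod s sᶜ
  have h₄ := hmod t tᶜ
  simp only [modularizeAt, compl_sup_eq_top, compl_inf_eq_bot, top_sup_eq, top_inf_eq, bot_sup_eq,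
    bot_inf_eq, sup_compl_eq_top, inf_compl_eq_bot, hp.bot, hp.top, hv.bot, hv.top,
    sup_eq_left.2 hst, inf_eq_right.2 hst] at h₁ h₂ h₃ h₄
  exact ⟨p, hp, hvp, hmod, le_antisymm (by linarith) (hvp s), le_antisymm (by linarith) (hvp t)⟩

/-! ### Inequalities for quotients -/

/-- Supermodularity of a quotient `n / d` with values in `[0, 1]`, at a quadruple formed by a meet
(index `i`), two elements (`a`, `b`) and their join (`u`). -/
theorem div_add_div_le_of_supermodular {nᵢ na nb nᵤ dᵢ da db dᵤ : ℝ}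
    (hdu : 0 < dᵤ) (hua : dᵤ ≤ da) (hub : dᵤ ≤ db) (hai : da ≤ dᵢ) (hbi : db ≤ dᵢ)
    (hni : 0 ≤ nᵢ) (hia : nᵢ ≤ na) (hib : nᵢ ≤ nb) (hna : na ≤ da)
    (hn : na + nb ≤ nᵤ + nᵢ)
    (hg : (dᵤ - nᵤ) + (dᵢ - nᵢ) ≤ (da - na) + (db - nb)) :
    na / da + nb / db ≤ nᵤ / dᵤ + nᵢ / dᵢ := by
  have hda : 0 < da := hdu.trans_le hua
  have hdb : 0 < db := hdu.trans_le hub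
  have hdi : 0 < dᵢ := hda.trans_le hai
  have hF : 0 ≤ na / da := div_nonneg (hni.trans hia) hda.le
  have hF₁ : na / da ≤ 1 := (div_le_one hda).2 hna
  have hFi : nᵢ / dᵢ ≤ na / da := by gcongr; exact hni.trans hia
  have h₁ : (nb - nᵢ) / db ≤ (nb - nᵢ) / dᵤ := by
    gcongr
  have h₂ : nᵢ / dᵢ * ((dᵢ - db) / db) ≤ na / da * ((dᵢ - db) / dᵤ) := by
    have : 0 ≤ dᵢ - db := sub_nonneg.2 hbi
    gcongr
  -- The slacks of `hn` and `hg`, weighted by `1 - na / da` and `na / da`, are exactly what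
  -- separates the increment `nᵤ / dᵤ - na / da` in `h₅` from the two terms bounded below in `h₁`
  -- and `h₂`.
  have h₃ : 0 ≤ ((nᵤ + nᵢ - na - nb) * (1 - na / da) +
      na / da * ((da - na) + (db - nb) - (dᵤ - nᵤ) - (dᵢ - nᵢ))) / dᵤ := by
    apply div_nonneg _ hdu.le
    apply add_nonneg <;> apply mul_nonneg <;> linarith
  have h₄ : nb / db - nᵢ / dᵢ = (nb - nᵢ) / db + nᵢ / dᵢ * ((dᵢ - db) / db) := by
    field_simp; ring
  have h₅ : nᵤ / dᵤ - na / da = (nb - nᵢ) / dᵤ + na / da * ((dᵢ - db) / dᵤ) +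
      ((nᵤ + nᵢ - na - nb) * (1 - na / da) +
      na / da * ((da - na) + (db - nb) - (dᵤ - nᵤ) - (dᵢ - nᵢ))) / dᵤ := by
    field_simp; ring
  linarith

/-- With `g = d - n` and `g₀ = d₀ - n₀`, cross-multiplication reduces the claim to `n₀ * g ≤ n *
g₀`. -/
theorem div_le_div_of_le_of_sub_le {n d n₀ d₀ : ℝ} (hd : 0 < d) (hd₀ : 0 < d₀) (hn₀ : 0 ≤ n₀)
    (hg₀ : 0 ≤ d - n) (hn : n₀ ≤ n) (hg : d - n ≤ d₀ - n₀) : n₀ / d₀ ≤ n / d := by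
  rw [div_le_div_iff₀ hd₀ hd]
  nlinarith [mul_le_mul_of_nonneg_left hg hn₀, mul_le_mul_of_nonneg_right hn (hg₀.trans hg)]

/-! ### The core and the conditional capacities -/

section Capacity

variable {Ω : Type*} {ν p : Set Ω → ℝ} {A B E : Set Ω} {α : ℝ}

/-- The numerator of the Extended RML conditional capacity. -/
def extRMLNum (ν : Set Ω → ℝ) (α : ℝ) (E A : Set Ω) : ℝ :=
  α * (ν (A ∪ Eᶜ) - ν Eᶜ) + (1 - α) * ν (A ∩ E)

theorem extRML_eq_div : extRML ν α E A = extRMLNum ν α E A / extRMLDenom ν α E A := rfl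

theorem extRMLDenom_sub_extRMLNum :
    extRMLDenom ν α E A - extRMLNum ν α E A = 1 - ν (A ∪ Eᶜ) := by
  simp only [extRMLDenom, extRMLNum]
  ring

theorem extRML_zero : extRML ν 0 E A = faginHalpern ν E A := by
  simp [extRML, extRMLDenom, faginHalpern]

variable [MeasurableSpace Ω]

theorem IsConvexCapacity.exists_mem_core_eq (hν : IsConvexCapacity ν) (hA : MeasurableSet A)
    (hB : MeasurableSet B) (hAB : A ⊆ B) : ∃ p ∈ core ν, p A = ν A ∧ p B = ν B := by
  classical
  have hv : IsSupermodularCapacity fun S : Subtype (MeasurableSet : Set Ω → Prop) => ν S :=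
    ⟨hν.empty, hν.univ, fun S T h => hν.mono S T S.2 T.2 h, fun S T => hν.convex S T S.2 T.2⟩
  obtain ⟨p, hp, hle, hmod, hpA, hpB⟩ :=
    hv.exists_modular_ge_eq (s := ⟨A, hA⟩) (t := ⟨B, hB⟩) hAB
  -- The value `0` off the sigma-algebra is arbitrary.
  refine ⟨fun S => if h : MeasurableSet S then p ⟨S, h⟩ else 0, ⟨⟨?_, ?_, ?_⟩, ?_⟩, ?_, ?_⟩
  · intro S hS
    rw [dif_pos hS, ← hp.bot]
    exact hp.mono bot_le
  · rw [dif_pos MeasurableSet.univ]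
    exact hp.top
  · intro S T hS hT hST
    rw [dif_pos hS, dif_pos hT, dif_pos (hS.union hT)]
    have h := hmod ⟨S, hS⟩ ⟨T, hT⟩
    have h' : (⟨S, hS⟩ ⊓ ⟨T, hT⟩ : Subtype (MeasurableSet : Set Ω → Prop)) = ⊥ :=
      Subtype.ext hST.inter_eq
    rw [h', hp.bot, add_zero] at h
    exact h
  · intro S hS
    simp only [dif_pos hS]
    exact hle ⟨S, hS⟩
  · simp only [dif_pos hA]
    exact hpA
  · simp only [dif_pos hB]
    exact hpB

theorem IsFinAddProb.compl (hp : IsFinAddProb p) (hA : MeasurableSet A) : p Aᶜ = 1 - p A := by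
  have h := hp.add A Aᶜ hA hA.compl disjoint_compl_right
  rw [Set.union_compl_self, hp.univ] at h
  linarith

theorem IsFinAddProb.inter_eq (hp : IsFinAddProb p) (hA : MeasurableSet A)
    (hE : MeasurableSet E) : p (A ∩ E) = p E - 1 + p (A ∪ Eᶜ) := by
  have h := hp.add (A ∩ E) Eᶜ (hA.inter hE) hE.compl
    (Set.disjoint_left.2 fun x hx hx' => hx' hx.2)
  have h' : A ∩ E ∪ Eᶜ = A ∪ Eᶜ := by
    rw [Set.inter_union_distrib_right, Set.union_compl_self, Set.inter_univ]
  rw [h', hp.compl hE] at h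
  linarith

/-- Domination at `Eᶜ` bounds `p E` by `1 - ν Eᶜ`, and a core element exact on `Eᶜ` attains the
bound. -/
theorem IsConvexCapacity.mem_coreMax_iff (hν : IsConvexCapacity ν) (hE : MeasurableSet E) :
    p ∈ coreMax ν E ↔ p ∈ core ν ∧ p E = 1 - ν Eᶜ := by
  refine and_congr_right fun hp => ⟨fun h => ?_, fun h q hq => ?_⟩
  · obtain ⟨q, hq, hqE, -⟩ := hν.exists_mem_core_eq hE.compl hE.compl subset_rfl
    have h₁ := h q hq
    have h₂ := hp.2 Eᶜ hE.compl
    rw [hq.1.compl hE] at hqE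
    rw [hp.1.compl hE] at h₂
    linarith
  · have h₂ := hq.2 Eᶜ hE.compl
    rw [hq.1.compl hE] at h₂
    linarith

theorem pos_of_mem_mixedCore (hE : MeasurableSet E) (hE0 : 0 < ν E)
    (hα : α ∈ Set.Icc (0 : ℝ) 1) (hp : p ∈ mixedCore ν α E) : 0 < p E := by
  obtain ⟨q₁, hq₁, q₂, hq₂, rfl⟩ := hp
  have h₁ := mul_le_mul_of_nonneg_left (hq₁.1.2 E hE) hα.1
  have h₂ := mul_le_mul_of_nonneg_left (hq₂.2 E hE) (sub_nonneg.2 hα.2)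
  linarith

/-- The set functions `A ↦ ν (A ∩ E)` and `A ↦ ν (A ∪ Eᶜ)` satisfy a joint convexity relation. -/
theorem IsConvexCapacity.inter_add_union_compl_le (hν : IsConvexCapacity ν) (hE : MeasurableSet E)
    (hA : MeasurableSet A) (hB : MeasurableSet B) (hAB : A ⊆ B) :
    ν (B ∩ E) + ν (A ∪ Eᶜ) ≤ ν (B ∪ Eᶜ) + ν (A ∩ E) := by
  have h := hν.convex (B ∩ E) (A ∪ Eᶜ) (hB.inter hE) (hA.union hE.compl)
  have h₁ : B ∩ E ∪ (A ∪ Eᶜ) = B ∪ Eᶜ := by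
    ext x; have := @hAB x
    simp only [Set.mem_union, Set.mem_inter_iff, Set.mem_compl_iff]; tauto
  have h₂ : B ∩ E ∩ (A ∪ Eᶜ) = A ∩ E := by
    ext x; have := @hAB x
    simp only [Set.mem_union, Set.mem_inter_iff, Set.mem_compl_iff]; tauto
  rwa [h₁, h₂] at h

theorem IsConvexCapacity.extRMLDenom_anti (hν : IsConvexCapacity ν) (hE : MeasurableSet E)
    (hα : α ≤ 1) (hA : MeasurableSet A) (hB : MeasurableSet B) (hAB : A ⊆ B) :
    extRMLDenom ν α E B ≤ extRMLDenom ν α E A := by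
  have h := hν.inter_add_union_compl_le hE hA hB hAB
  unfold extRMLDenom
  have h' : ν (B ∩ E) + 1 - ν (B ∪ Eᶜ) ≤ ν (A ∩ E) + 1 - ν (A ∪ Eᶜ) := by linarith
  linarith [mul_le_mul_of_nonneg_left h' (sub_nonneg.2 hα)]

/-- The denominator is antitone in `A`, so it is smallest at the whole space, where it averages `1 -
ν Eᶜ ≥ ν E` and `ν E`. -/
theorem IsConvexCapacity.le_extRMLDenom (hν : IsConvexCapacity ν) (hE : MeasurableSet E)
    (hα : α ∈ Set.Icc (0 : ℝ) 1) (hA : MeasurableSet A) : ν E ≤ extRMLDenom ν α E A := by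
  refine le_trans ?_ (hν.extRMLDenom_anti hE hα.2 hA .univ A.subset_univ)
  have h := hν.convex E Eᶜ hE hE.compl
  rw [Set.union_compl_self, Set.inter_compl_self, hν.univ, hν.empty] at h
  have h' : ν E ≤ 1 - ν Eᶜ := by linarith
  simp only [extRMLDenom, Set.univ_inter, Set.univ_union, hν.univ]
  linarith [mul_le_mul_of_nonneg_left h' hα.1]

theorem IsConvexCapacity.extRMLNum_mono (hν : IsConvexCapacity ν) (hE : MeasurableSet E)
    (hα : α ∈ Set.Icc (0 : ℝ) 1) (hA : MeasurableSet A) (hB : MeasurableSet B) (hAB : A ⊆ B) :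
    extRMLNum ν α E A ≤ extRMLNum ν α E B := by
  have h₁ := hν.mono _ _ (hA.union hE.compl) (hB.union hE.compl) (Set.union_subset_union_left _ hAB)
  have h₂ := hν.mono _ _ (hA.inter hE) (hB.inter hE) (Set.inter_subset_inter_left _ hAB)
  have := mul_le_mul_of_nonneg_left h₁ hα.1
  have := mul_le_mul_of_nonneg_left h₂ (sub_nonneg.2 hα.2)
  unfold extRMLNum
  linarith

theorem IsConvexCapacity.extRMLNum_empty (hν : IsConvexCapacity ν) : extRMLNum ν α E ∅ = 0 := by
  simp [extRMLNum, hν.empty]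

theorem IsConvexCapacity.extRMLNum_nonneg (hν : IsConvexCapacity ν) (hE : MeasurableSet E)
    (hα : α ∈ Set.Icc (0 : ℝ) 1) (hA : MeasurableSet A) : 0 ≤ extRMLNum ν α E A :=
  hν.extRMLNum_empty.symm.trans_le (hν.extRMLNum_mono hE hα .empty hA A.empty_subset)

theorem IsConvexCapacity.extRMLNum_le_extRMLDenom (hν : IsConvexCapacity ν)
    (hE : MeasurableSet E) (hA : MeasurableSet A) :
    extRMLNum ν α E A ≤ extRMLDenom ν α E A := by
  have h := hν.mono _ _ (hA.union hE.compl) .univ (Set.subset_univ _)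
  rw [hν.univ] at h
  linarith [extRMLDenom_sub_extRMLNum (ν := ν) (α := α) (E := E) (A := A)]

theorem IsConvexCapacity.union_compl_convex (hν : IsConvexCapacity ν) (hE : MeasurableSet E)
    (hA : MeasurableSet A) (hB : MeasurableSet B) :
    ν (A ∪ Eᶜ) + ν (B ∪ Eᶜ) ≤ ν (A ∪ B ∪ Eᶜ) + ν (A ∩ B ∪ Eᶜ) := by
  rw [Set.union_union_distrib_right, Set.inter_union_distrib_right]
  exact hν.convex _ _ (hA.union hE.compl) (hB.union hE.compl)

theorem IsConvexCapacity.inter_convex (hν : IsConvexCapacity ν) (hE : MeasurableSet E)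
    (hA : MeasurableSet A) (hB : MeasurableSet B) :
    ν (A ∩ E) + ν (B ∩ E) ≤ ν ((A ∪ B) ∩ E) + ν (A ∩ B ∩ E) := by
  rw [Set.union_inter_distrib_right, Set.inter_inter_distrib_right]
  exact hν.convex _ _ (hA.inter hE) (hB.inter hE)

theorem IsConvexCapacity.isConvexCapacity_extRML (hν : IsConvexCapacity ν) (hE : MeasurableSet E) (hE0 : 0 < ν E)
    (hα : α ∈ Set.Icc (0 : ℝ) 1) : IsConvexCapacity fun A => extRML ν α E A := by
  have hpos : ∀ {A : Set Ω}, MeasurableSet A → 0 < extRMLDenom ν α E A :=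
    fun hA => hE0.trans_le (hν.le_extRMLDenom hE hα hA)
  refine ⟨⟨?_, ?_, fun A B hA hB hAB => ?_⟩, fun A B hA hB => ?_⟩
  · rw [extRML_eq_div, hν.extRMLNum_empty, zero_div]
  · have h := extRMLDenom_sub_extRMLNum (ν := ν) (α := α) (E := E) (A := Set.univ)
    rw [Set.univ_union, hν.univ, sub_self, sub_eq_zero] at h
    rw [extRML_eq_div, ← h, div_self (hpos .univ).ne']
  · exact div_le_div₀ (hν.extRMLNum_nonneg hE hα hB) (hν.extRMLNum_mono hE hα hA hB hAB) (hpos hB)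
      (hν.extRMLDenom_anti hE hα.2 hA hB hAB)
  · have hU := hA.union hB
    have hI := hA.inter hB
    have hM := hν.union_compl_convex hE hA hB
    refine div_add_div_le_of_supermodular (hpos hU)
      (hν.extRMLDenom_anti hE hα.2 hA hU Set.subset_union_left)
      (hν.extRMLDenom_anti hE hα.2 hB hU Set.subset_union_right)
      (hν.extRMLDenom_anti hE hα.2 hI hA Set.inter_subset_left)
      (hν.extRMLDenom_anti hE hα.2 hI hB Set.inter_subset_right)
      (hν.extRMLNum_nonneg hE hα hI)
      (hν.extRMLNum_mono hE hα hI hA Set.inter_subset_left)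
      (hν.extRMLNum_mono hE hα hI hB Set.inter_subset_right)
      (hν.extRMLNum_le_extRMLDenom hE hA) ?_ ?_
    · have h₁ := mul_le_mul_of_nonneg_left hM hα.1
      have h₂ := mul_le_mul_of_nonneg_left (hν.inter_convex hE hA hB) (sub_nonneg.2 hα.2)
      linarith
    -- Denominator minus numerator is `1 - ν (A ∪ Eᶜ)`, hence submodular.
    · change extRMLDenom ν α E _ - extRMLNum ν α E _ + (extRMLDenom ν α E _ - extRMLNum ν α E _) ≤
        extRMLDenom ν α E _ - extRMLNum ν α E _ + (extRMLDenom ν α E _ - extRMLNum ν α E _)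
      simp only [extRMLDenom_sub_extRMLNum]
      linarith

theorem IsConvexCapacity.isLeast_extRML (hν : IsConvexCapacity ν) (hE : MeasurableSet E)
    (hE0 : 0 < ν E) (hα : α ∈ Set.Icc (0 : ℝ) 1) (hA : MeasurableSet A) :
    IsLeast {x : ℝ | ∃ p ∈ mixedCore ν α E, x = p (A ∩ E) / p E} (extRML ν α E A) := by
  have hsub : A ∩ E ⊆ A ∪ Eᶜ := Set.inter_subset_left.trans Set.subset_union_left
  constructor
  -- Exactness of `q₁` on `Eᶜ` makes it a maximizer; exactness of both priors on `A ∪ Eᶜ` minimizes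
  -- the numerator and maximizes the gap.
  · obtain ⟨q₁, hq₁, h₁, h₂⟩ := hν.exists_mem_core_eq hE.compl (hA.union hE.compl)
      Set.subset_union_right
    obtain ⟨q₂, hq₂, h₃, h₄⟩ := hν.exists_mem_core_eq (hA.inter hE) (hA.union hE.compl) hsub
    rw [hq₁.1.compl hE] at h₁
    have h₅ := hq₁.1.inter_eq hA hE
    have h₆ := hq₂.1.inter_eq hA hE
    refine ⟨_, ⟨q₁, (hν.mem_coreMax_iff hE).2 ⟨hq₁, by linarith⟩, q₂, hq₂, rfl⟩, ?_⟩
    have h₇ : q₁ E = 1 - ν Eᶜ := by linarith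
    have h₈ : q₁ (A ∩ E) = ν (A ∪ Eᶜ) - ν Eᶜ := by linarith
    have h₉ : q₂ E = ν (A ∩ E) + 1 - ν (A ∪ Eᶜ) := by linarith
    simp only [h₃, h₇, h₈, h₉, extRML, extRMLDenom]
  · rintro _ ⟨p, hp, rfl⟩
    have hpE := pos_of_mem_mixedCore hE hE0 hα hp
    obtain ⟨q₁, hq₁, q₂, hq₂, rfl⟩ := hp
    obtain ⟨hq₁, hq₁E⟩ := (hν.mem_coreMax_iff hE).1 hq₁
    have hα' := sub_nonneg.2 hα.2
    have h₁ := hq₁.1.inter_eq hA hE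
    have h₂ := hq₂.1.inter_eq hA hE
    have hn₁ := hq₁.2 _ (hA.union hE.compl)
    have hn₂ := hq₂.2 _ (hA.union hE.compl)
    have hn₃ := hq₂.2 _ (hA.inter hE)
    have hle : ∀ q ∈ core ν, q (A ∪ Eᶜ) ≤ 1 := fun q hq => by
      have := hq.1.compl (hA.union hE.compl)
      linarith [hq.1.nonneg _ (hA.union hE.compl).compl]
    rw [extRML_eq_div]
    refine div_le_div_of_le_of_sub_le hpE (hE0.trans_le (hν.le_extRMLDenom hE hα hA))
      (hν.extRMLNum_nonneg hE hα hA) ?_ ?_ ?_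
    · have h₃ := mul_nonneg hα.1 (sub_nonneg.2 (hle q₁ hq₁))
      have h₄ := mul_nonneg hα' (sub_nonneg.2 (hle q₂ hq₂))
      simp only [h₁, h₂]
      linarith
    -- For a maximizer `q₁ E` is fixed, so `q₁ (A ∩ E) = q₁ (A ∪ Eᶜ) - ν Eᶜ`, which explains the
    -- first term of the numerator.
    · have h₃ := mul_le_mul_of_nonneg_left hn₁ hα.1
      have h₄ := mul_le_mul_of_nonneg_left hn₃ hα'
      simp only [h₁, hq₁E, extRMLNum]
      linarith
    · have h₃ := mul_le_mul_of_nonneg_left hn₁ hα.1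
      have h₄ := mul_le_mul_of_nonneg_left hn₂ hα'
      rw [extRMLDenom_sub_extRMLNum]
      simp only [h₁, h₂]
      linarith

theorem IsConvexCapacity.mixedCore_zero (hν : IsConvexCapacity ν) (hE : MeasurableSet E) :
    mixedCore ν 0 E = core ν := by
  ext p
  constructor
  · rintro ⟨q₁, -, q₂, hq₂, rfl⟩
    simpa using hq₂
  · intro hp
    -- Even with weight zero, a maximizer must exist for the mixture to be nonempty.
    obtain ⟨q, hq, hqE, -⟩ := hν.exists_mem_core_eq hE.compl hE.compl subset_rfl
    rw [hq.1.compl hE] at hqE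
    exact ⟨q, (hν.mem_coreMax_iff hE).2 ⟨hq, by linarith⟩, p, hp, by simp⟩

end Capacity

theorem proposition1 {Ω : Type*} [MeasurableSpace Ω] (ν : Set Ω → ℝ) (hν : IsConvexCapacity ν)
    (E : Set Ω) (hE : MeasurableSet E) (hE0 : 0 < ν E)
    (α : ℝ) (hα : α ∈ Set.Icc (0 : ℝ) 1) :
    -- the quotients below have positive denominators
    (∀ A : Set Ω, MeasurableSet A → 0 < extRMLDenom ν α E A) ∧
    (∀ p ∈ mixedCore ν α E, 0 < p E) ∧
    -- the Extended RML conditional capacity is a convex capacity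
    IsConvexCapacity (fun A => extRML ν α E A) ∧
    -- it is the (attained) minimum of the conditional probabilities over the mixed set of priors
    (∀ A : Set Ω, MeasurableSet A →
      IsLeast {x : ℝ | ∃ p ∈ mixedCore ν α E, x = p (A ∩ E) / p E} (extRML ν α E A)) ∧
    -- and the Fagin-Halpern capacity is the minimum over the whole core
    (∀ A : Set Ω, MeasurableSet A →
      IsLeast {x : ℝ | ∃ p ∈ core ν, x = p (A ∩ E) / p E} (faginHalpern ν E A)) := by
  refine ⟨fun A hA => hE0.trans_le (hν.le_extRMLDenom hE hα hA),
    fun p hp => pos_of_mem_mixedCore hE hE0 hα hp, hν.isConvexCapacity_extRML hE hE0 hα,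
    fun A hA => hν.isLeast_extRML hE hE0 hα hA, fun A hA => ?_⟩
  rw [← extRML_zero, ← hν.mixedCore_zero hE]
  exact hν.isLeast_extRML hE hE0 (Set.left_mem_Icc.2 zero_le_one) hA
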